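/- Write $[M]=\{0,1,\dots,M-1\}$. A set $X\subseteq[M]^n$ is called symmetric if $(x_{\sigma(1)},\dots,x_{\sigma(n)})\in X$ for all $x\in X$ and $\sigma\in S_n$, and a function $f:X\to\{0,1\}$ on a symmetric set $X$ is called symmetric if $f(x_{\sigma(1)},\dots,x_{\sigma(n)})=f(x)$ for all $x\in X$ and $\sigma\in S_n$ (so that $f(x)$ depends only on the type of $x$, i.e. on the multiset $\{x_1,\dots,x_n\}$). Let $R(f)$ and $Q(f)$ denote the bounded-error randomized and quantum query complexities of $f$: the least number $T$ such that some randomized (respectively quantum) algorithm that makes at most $T$ queries to the entries of $x$ outputs $f(x)$ with error probability less than $1/3$ for every $x\in X$. There is an absolute constant $c>0$ such that for all integers $M\ge 2$ and $n\ge 0$, every symmetric $X\subseteq[M]^n$ and every symmetric $f:X\to\{0,1\}$, $$Q(f)\ \ge\ c\,\frac{R(f)^{1/8}}{M\,\log^{1/8}M}.$$ Equivalently, there is an absolute constant $C>0$ such that $R(f)\le C\,Q(f)^8\,M^8\log M$ for all such $M,n,X,f$ (and this second inequality also holds for $M=1$). -/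

import Mathlib

namespace QueryComplexity

/-- An input of length `n` over the alphabet `[M] = {0, …, M - 1}`. -/
abbrev Input (n M : ℕ) : Type := Fin n → Fin M

/-- A promise is symmetric if it is invariant under permutations of the positions. -/
def IsSymmetricPromise {n M : ℕ} (X : Set (Input n M)) : Prop :=
  ∀ x ∈ X, ∀ σ : Equiv.Perm (Fin n), x ∘ σ ∈ X

/-- A partial function is symmetric if its value does not change when the positions of the
input are permuted, i.e. if it depends only on the multiset of entries of the input. -/
def IsSymmetricFunction {n M : ℕ} {X : Set (Input n M)} (f : X → Bool) : Prop :=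
  ∀ (x y : X) (σ : Equiv.Perm (Fin n)), (y : Input n M) = (x : Input n M) ∘ σ → f y = f x

/-! ### Randomized query complexity -/

/-- Deterministic adaptive query algorithms with one-bit output. -/
inductive DecisionTree (n M : ℕ) : Type
  | leaf (b : Bool) : DecisionTree n M
  | query (i : Fin n) (next : Fin M → DecisionTree n M) : DecisionTree n M

namespace DecisionTree

/-- The output on the input `x`. -/
def eval {n M : ℕ} : DecisionTree n M → Input n M → Bool
  | leaf b, _ => b
  | query i next, x => (next (x i)).eval x

/-- The number of queries made on the input `x`. -/
def cost {n M : ℕ} : DecisionTree n M → Input n M → ℕ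
  | leaf _, _ => 0
  | query i next, x => (next (x i)).cost x + 1

end DecisionTree

/-- The randomized algorithm `p`, a probability distribution on deterministic query algorithms,
makes at most `T` queries on every input of the promise, whatever its coin tosses, and errs
with probability less than `1 / 3` on each of them. -/
def RandomizedComputes {n M : ℕ} {X : Set (Input n M)} (p : PMF (DecisionTree n M)) (T : ℕ)
    (f : X → Bool) : Prop :=
  ∀ x : X, (∀ t ∈ p.support, t.cost x ≤ T) ∧ p.toOuterMeasure {t | t.eval x ≠ f x} < 1 / 3

/-- The bounded-error randomized query complexity `R(f)`. -/
noncomputable def R {n M : ℕ} {X : Set (Input n M)} (f : X → Bool) : ℕ :=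
  sInf {T : ℕ | ∃ p : PMF (DecisionTree n M), RandomizedComputes p T f}

/-! ### Quantum query complexity -/

/-- Labels `(i, b, w)` of the computational basis: a query register, which holds a position or
`none` (no position is queried), an answer register, and a workspace. -/
abbrev Basis (n M : ℕ) (W : Type) : Type := Option (Fin n) × Fin M × W

/-- The oracle `|i, b, w⟩ ↦ |i, b + x i mod M, w⟩`, `|none, b, w⟩ ↦ |none, b, w⟩`,
acting on amplitude vectors. -/
def oracle {n M : ℕ} {W : Type} (x : Input n M) (ψ : Basis n M W → ℂ) : Basis n M W → ℂ
  | (some i, b, w) => ψ (some i, b - x i, w)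
  | (none, b, w) => ψ (none, b, w)

/-- A quantum query algorithm: a finite workspace, an initial basis state, input-independent
unitaries `unitary 0, unitary 1, …` applied before, between and after the queries, and the output
bit read off from a final measurement in the computational basis. -/
structure QuantumAlgorithm (n M : ℕ) where
  Work : Type
  [fintypeWork : Fintype Work]
  [decEqWork : DecidableEq Work]
  start : Basis n M Work
  unitary : ℕ → Matrix.unitaryGroup (Basis n M Work) ℂ
  out : Basis n M Work → Bool

attribute [instance] QuantumAlgorithm.fintypeWork QuantumAlgorithm.decEqWork

namespace QuantumAlgorithm

/-- The state after `T` queries, `U_T O_x U_{T-1} ⋯ O_x U_0 |start⟩`. -/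
def state {n M : ℕ} (A : QuantumAlgorithm n M) (x : Input n M) : ℕ → Basis n M A.Work → ℂ
  | 0 => (A.unitary 0).1.mulVec (Pi.single A.start 1)
  | T + 1 => (A.unitary (T + 1)).1.mulVec (oracle x (A.state x T))

/-- The probability that the algorithm, stopped after `T` queries, outputs `b`. -/
noncomputable def prob {n M : ℕ} (A : QuantumAlgorithm n M) (x : Input n M) (T : ℕ)
    (b : Bool) : ℝ :=
  ∑ z : Basis n M A.Work, if A.out z = b then ‖A.state x T z‖ ^ 2 else 0

end QuantumAlgorithm

/-- `A` with `T` queries errs with probability less than `1 / 3` on every input of the promise. -/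
def QuantumComputes {n M : ℕ} {X : Set (Input n M)} (A : QuantumAlgorithm n M) (T : ℕ)
    (f : X → Bool) : Prop :=
  ∀ x : X, A.prob x T (!f x) < 1 / 3

/-- The bounded-error quantum query complexity `Q(f)`. -/
noncomputable def Q {n M : ℕ} {X : Set (Input n M)} (f : X → Bool) : ℕ :=
  sInf {T : ℕ | ∃ A : QuantumAlgorithm n M, QuantumComputes A T f}

/-! ### Both infima are over nonempty sets -/

/-- Reading the whole input is a randomized algorithm with `n` queries. -/
theorem exists_randomizedComputes {n M : ℕ} {X : Set (Input n M)} (f : X → Bool) :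
    ∃ p : PMF (DecisionTree n M), RandomizedComputes p n f := by
  classical
  have key : ∀ (k : ℕ), k ≤ n → ∀ g : Input n M → Bool,
      (∀ x y : Input n M, (∀ i : Fin n, i.1 < k → x i = y i) → g x = g y) →
      ∃ t : DecisionTree n M, ∀ x, t.eval x = g x ∧ t.cost x ≤ k := by
    intro k
    induction k with
    | zero =>
      intro _ g hg
      by_cases hne : Nonempty (Input n M)
      · obtain ⟨y⟩ := hne
        exact ⟨.leaf (g y), fun x => ⟨hg y x (by simp), le_rfl⟩⟩
      · exact ⟨.leaf false, fun x => (hne ⟨x⟩).elim⟩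
    | succ k ih =>
      intro hk g hg
      have h : ∀ a : Fin M, ∃ t : DecisionTree n M, ∀ x,
          t.eval x = g (Function.update x ⟨k, hk⟩ a) ∧ t.cost x ≤ k := by
        intro a
        refine ih (by omega) (fun x => g (Function.update x ⟨k, hk⟩ a)) ?_
        intro x y hxy
        apply hg
        intro i hi
        by_cases h : i = ⟨k, hk⟩
        · subst h; simp
        · have : i.1 ≠ k := fun h' => h (Fin.ext h')
          simp [Function.update_of_ne h, hxy i (by omega)]
      choose t ht using h
      refine ⟨.query ⟨k, hk⟩ t, fun x => ⟨?_, ?_⟩⟩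
      · simp [DecisionTree.eval, (ht _ x).1]
      · simpa [DecisionTree.cost] using (ht (x ⟨k, hk⟩) x).2
  obtain ⟨t, ht⟩ := key n le_rfl (fun x => if h : x ∈ X then f ⟨x, h⟩ else false)
    (fun x y h => by rw [funext fun i => h i i.2])
  refine ⟨PMF.pure t, fun x => ⟨?_, ?_⟩⟩
  · intro t' h
    rw [PMF.support_pure, Set.mem_singleton_iff] at h
    exact h ▸ (ht x).2
  · rw [PMF.toOuterMeasure_pure_apply, if_neg]
    · simp
    · simp [(ht x).1]

/-- Reading the whole input is a quantum algorithm with `n` queries. -/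
theorem exists_quantumComputes {n M : ℕ} (hM : 1 ≤ M) {X : Set (Input n M)} (f : X → Bool) :
    ∃ A : QuantumAlgorithm n M, QuantumComputes A n f := by
  classical
  have : NeZero M := ⟨by omega⟩
  let B := Basis n M (Input n M)
  let idx : ℕ → Option (Fin n) := fun k => if h : k < n then some ⟨k, h⟩ else none
  let store : B → B := fun z => match z with
    | (some i, b, w) => (some i, w i, Function.update w i b)
    | (none, b, w) => (none, b, w)
  have hstore : Function.Involutive store := by
    rintro ⟨_ | i, b, w⟩ <;> simp [store]
  let step : ℕ → Equiv.Perm B := fun k => (hstore.toPerm store).trans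
    (Equiv.prodCongr (Equiv.swap (idx k) (idx (k + 1))) (Equiv.refl _))
  let P : Equiv.Perm B → Matrix.unitaryGroup B ℂ := fun σ =>
    ⟨(σ⁻¹).permMatrix ℂ, by
      rw [Matrix.mem_unitaryGroup_iff, Matrix.star_eq_conjTranspose,
        Matrix.conjTranspose_permMatrix, ← Matrix.permMatrix_mul]
      simp⟩
  have hP : ∀ (σ : Equiv.Perm B) (z : B),
      (P σ).1.mulVec (Pi.single z 1) = Pi.single (σ z) (1 : ℂ) := by
    intro σ z
    show ((σ⁻¹).permMatrix ℂ).mulVec _ = _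
    rw [Matrix.permMatrix_mulVec]
    ext y
    simp only [Function.comp, Pi.single_apply]
    congr 1
    rw [Equiv.Perm.inv_eq_iff_eq, eq_iff_iff]
  let A : QuantumAlgorithm n M :=
    { Work := Input n M
      start := (idx 0, 0, 0)
      unitary := fun k => match k with
        | 0 => P 1
        | k + 1 => P (step k)
      out := fun z => if h : z.2.2 ∈ X then f ⟨z.2.2, h⟩ else false }
  have hst : ∀ x : Input n M, ∀ k ≤ n,
      A.state x k = Pi.single (idx k, 0, fun i => if i.1 < k then x i else 0) (1 : ℂ) := by
    intro x k
    induction k with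
    | zero =>
      intro _
      exact hP 1 _
    | succ k ih =>
      intro hk
      have hidx : idx k = some ⟨k, hk⟩ := by simp only [idx]; rw [dif_pos]
      have ho : oracle x (A.state x k) =
          Pi.single ((idx k, x ⟨k, hk⟩, fun i => if i.1 < k then x i else 0) : B) (1 : ℂ) := by
        rw [ih (by omega), hidx]
        funext z
        obtain ⟨_ | i, b, w⟩ := z
        · simp [oracle]
        · simp only [oracle, Pi.single_apply, Prod.mk.injEq, Option.some.injEq]
          congr 1
          rw [eq_iff_iff]
          constructor
          · rintro ⟨rfl, h, h'⟩
            exact ⟨rfl, sub_eq_zero.1 h, h'⟩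
          · rintro ⟨rfl, h, h'⟩
            exact ⟨rfl, sub_eq_zero.2 h, h'⟩
      show (P (step k)).1.mulVec (oracle x (A.state x k)) = _
      rw [ho, hP]
      congr 1
      have h1 : store (idx k, x ⟨k, hk⟩, fun i => if i.1 < k then x i else 0) =
          (idx k, 0, fun i => if i.1 < k + 1 then x i else 0) := by
        rw [hidx]
        simp only [store, lt_irrefl, if_false]
        refine congrArg (fun w => (some _, 0, w)) (funext fun i => ?_)
        by_cases h : i = ⟨k, hk⟩
        · subst h; simp
        · have h' : i.1 ≠ k := fun h' => h (Fin.ext h')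
          rw [Function.update_of_ne h]
          have : i.1 < k ↔ i.1 < k + 1 := by omega
          simp [this]
      show Prod.map _ _ (store _) = _
      rw [h1]
      simp [Prod.map]
  refine ⟨A, fun x => ?_⟩
  have : A.prob x n (!f x) = 0 := by
    unfold QuantumAlgorithm.prob
    refine Finset.sum_eq_zero fun z _ => ?_
    split_ifs with h
    · rw [hst x n le_rfl]
      have hz : z ≠ (idx n, 0, fun i => if i.1 < n then x.1 i else 0) := by
        rintro rfl
        simp [A] at h
      rw [Pi.single_eq_of_ne hz]
      simp
    · rfl
  rw [this]
  norm_num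

end QueryComplexity

/-!
After `T` queries the acceptance probability of a quantum algorithm is a function of degree at most
`2 * T` in the input letters. Its average over the permutations of the positions is symmetric, has
the same degree, and separates the inputs with value `true` from those with value `false` by
`1 / 3`.

Let `F` be a symmetric function of degree `d` with values in `[0, 1]`. Some letter `b` occurs at
least `n / M` times in a given word. After `k` of the occurrences of `b` are replaced by another
letter, the value of `F` is a polynomial of degree at most `d` in `k`, bounded at all these
integers `k`; so by Markov's inequality replacing a single letter changes `F` by
`O(d ^ 2 * M / n)`. Two words of different types reach a common type by replacing by `b` the letters
that one has in excess of the other, hence `F` is Lipschitz in the letter frequencies, with constant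
`O(d ^ 2 * M ^ 2)`.

Inputs with different values therefore have frequencies at distance of order at least
`1 / (M ^ 2 * Q(f) ^ 2)`, and by Chebyshev's inequality `O(M ^ 4 * Q(f) ^ 4)` random samples
suffice to tell them apart.
-/

namespace QueryComplexity

section Markov

open Polynomial Set

variable {p : ℝ[X]} {d : ℕ} {B a b x y : ℝ}

theorem eval_derivative_right_le (hp : p.natDegree ≤ d) (hab : a < b)
    (hB : ∀ t ∈ Icc a b, |p.eval t| ≤ B) :
    (derivative p).eval b ≤ 2 * d ^ 2 * B / (b - a) := by
  have hba : 0 < b - a := sub_pos.2 hab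
  rcases ((abs_nonneg _).trans (hB a (left_mem_Icc.2 hab.le))).eq_or_lt with rfl | hB0
  · have hp0 : p = 0 := eq_zero_of_infinite_isRoot p <|
      (Icc_infinite hab).mono fun t ht => abs_nonpos_iff.1 (hB t ht)
    simp [hp0]
  set ℓ : ℝ[X] := C ((b - a) / 2) * (X + 1) + C a with hℓ
  set P : ℝ[X] := C B⁻¹ * p.comp ℓ with hP
  have hℓ_deg : ℓ.natDegree ≤ 1 := by rw [hℓ]; compute_degree
  have hP_deg : P.degree ≤ d := natDegree_le_iff_degree_le.1 <|
    (natDegree_C_mul_le _ _).trans <| natDegree_comp_le.trans <|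
      (Nat.mul_le_mul hp hℓ_deg).trans_eq (mul_one d)
  have hP_bound : ∀ u ∈ Icc (-1 : ℝ) 1, |P.eval u| ≤ 1 := by
    intro u hu
    have hmem : ℓ.eval u ∈ Icc a b := by
      simp only [hℓ, eval_add, eval_mul, eval_C, eval_X, eval_one]
      constructor <;> nlinarith [hu.1, hu.2]
    rw [hP, eval_mul, eval_C, eval_comp, abs_mul, abs_inv, abs_of_pos hB0, inv_mul_le_iff₀ hB0,
      mul_one]
    exact hB _ hmem
  have hP_deriv : (derivative P).eval 1 = B⁻¹ * ((b - a) / 2) * (derivative p).eval b := by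
    have hℓ_one : ℓ.eval 1 = b := by simp [hℓ]; ring
    have hℓ_deriv : derivative ℓ = C ((b - a) / 2) := by simp [hℓ]
    rw [hP, derivative_C_mul, derivative_comp, hℓ_deriv, eval_mul, eval_mul, eval_comp, hℓ_one,
      eval_C, eval_C]
    ring
  have hMarkov := Chebyshev.eval_iterate_derivative_le_of_forall_abs_le_one (k := 1) le_rfl
    hP_deg hP_bound
  simp only [Function.iterate_one, Chebyshev.derivative_T_eval_one, hP_deriv,
    Int.cast_natCast] at hMarkov
  rw [le_div_iff₀ hba]
  calc (derivative p).eval b * (b - a)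
      = 2 * B * (B⁻¹ * ((b - a) / 2) * (derivative p).eval b) := by field_simp
    _ ≤ 2 * B * d ^ 2 := by gcongr
    _ = 2 * d ^ 2 * B := by ring

theorem abs_eval_derivative_right_le (hp : p.natDegree ≤ d) (hab : a < b)
    (hB : ∀ t ∈ Icc a b, |p.eval t| ≤ B) :
    |(derivative p).eval b| ≤ 2 * d ^ 2 * B / (b - a) := by
  refine abs_le'.2 ⟨eval_derivative_right_le hp hab hB, ?_⟩
  simpa using eval_derivative_right_le (p := -p) (by simpa using hp) hab (by simpa using hB)

theorem abs_eval_derivative_left_le (hp : p.natDegree ≤ d) (hab : a < b)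
    (hB : ∀ t ∈ Icc a b, |p.eval t| ≤ B) :
    |(derivative p).eval a| ≤ 2 * d ^ 2 * B / (b - a) := by
  have hreflect : (C (a + b) - X : ℝ[X]).natDegree ≤ 1 := by compute_degree
  have hright := abs_eval_derivative_right_le (p := p.comp (C (a + b) - X))
    (natDegree_comp_le.trans ((Nat.mul_le_mul hp hreflect).trans_eq (mul_one d))) hab
    fun t ht => by
      rw [eval_comp, eval_sub, eval_C, eval_X]
      exact hB _ ⟨by linarith [ht.2], by linarith [ht.1]⟩
  simpa [derivative_comp] using hright

theorem abs_eval_derivative_le (hp : p.natDegree ≤ d) (hab : a < b)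
    (hB : ∀ t ∈ Icc a b, |p.eval t| ≤ B) (hx : x ∈ Icc a b) :
    |(derivative p).eval x| ≤ 4 * d ^ 2 * B / (b - a) := by
  have hB0 : 0 ≤ B := (abs_nonneg _).trans (hB x hx)
  have hhalf : ∀ s, (b - a) / 2 ≤ s → 2 * d ^ 2 * B / s ≤ 4 * d ^ 2 * B / (b - a) := by
    intro s hs
    calc 2 * d ^ 2 * B / s ≤ 2 * d ^ 2 * B / ((b - a) / 2) := by
          have : 0 < (b - a) / 2 := by linarith
          gcongr
      _ = 4 * d ^ 2 * B / (b - a) := by rw [div_div_eq_mul_div]; ring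
  rcases le_total ((a + b) / 2) x with hmid | hmid
  · exact (abs_eval_derivative_right_le hp (by linarith)
      fun t ht => hB t ⟨ht.1, ht.2.trans hx.2⟩).trans (hhalf _ (by linarith))
  · exact (abs_eval_derivative_left_le hp (by linarith)
      fun t ht => hB t ⟨hx.1.trans ht.1, ht.2⟩).trans (hhalf _ (by linarith))

theorem abs_eval_sub_eval_le (hp : p.natDegree ≤ d) (hab : a < b)
    (hB : ∀ t ∈ Icc a b, |p.eval t| ≤ B) (hx : x ∈ Icc a b) (hy : y ∈ Icc a b) :
    |p.eval y - p.eval x| ≤ 4 * d ^ 2 * B / (b - a) * |y - x| :=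
  (convex_Icc a b).norm_image_sub_le_of_norm_deriv_le (f := fun t => p.eval t)
    (fun _ _ => p.differentiableAt)
    (fun t ht => by rw [Polynomial.deriv]; exact abs_eval_derivative_le hp hab hB ht) hx hy

/- At a point where `|p|` attains its maximum `A` on `[0, L]`, the nearest smaller integer is at
distance at most `1`, so `A ≤ B + 4 * d ^ 2 / L * A ≤ B + A / 2`. -/
theorem abs_eval_le_two_mul_of_forall_nat {L : ℕ} (hp : p.natDegree ≤ d) (hL0 : 0 < L)
    (hL : 8 * d ^ 2 ≤ L) (hB : ∀ i ≤ L, |p.eval (i : ℝ)| ≤ B) (hx : x ∈ Icc (0 : ℝ) L) :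
    |p.eval x| ≤ 2 * B := by
  have hL0' : (0 : ℝ) < L := by exact_mod_cast hL0
  have hL' : 8 * (d : ℝ) ^ 2 ≤ L := by exact_mod_cast hL
  obtain ⟨s, hs, hmax⟩ := isCompact_Icc.exists_isMaxOn (nonempty_Icc.2 hL0'.le)
    (f := fun t => |p.eval t|) p.continuous.abs.continuousOn
  have hfloor : ⌊s⌋₊ ≤ L := Nat.floor_le_of_le hs.2
  have hdist : |s - ⌊s⌋₊| ≤ 1 :=
    abs_le.2 ⟨by linarith [Nat.floor_le hs.1], by linarith [Nat.lt_floor_add_one s]⟩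
  have hslope : 4 * d ^ 2 * |p.eval s| / L ≤ |p.eval s| / 2 := by
    rw [div_le_div_iff₀ hL0' two_pos]
    nlinarith [abs_nonneg (p.eval s)]
  have hstep : |p.eval s - p.eval (⌊s⌋₊ : ℝ)| ≤ |p.eval s| / 2 :=
    calc |p.eval s - p.eval (⌊s⌋₊ : ℝ)|
        ≤ 4 * d ^ 2 * |p.eval s| / (L - 0) * |s - ⌊s⌋₊| :=
          abs_eval_sub_eval_le hp hL0' hmax ⟨Nat.cast_nonneg _, Nat.cast_le.2 hfloor⟩ hs
      _ ≤ |p.eval s| / 2 * 1 := by rw [sub_zero]; gcongr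
      _ = |p.eval s| / 2 := mul_one _
  have hx_le : |p.eval x| ≤ |p.eval s| := hmax hx
  linarith [abs_sub_abs_le_abs_sub (p.eval s) (p.eval (⌊s⌋₊ : ℝ)), hB _ hfloor]

theorem abs_eval_sub_eval_le_of_forall_nat {L : ℕ} (hp : p.natDegree ≤ d) (hL0 : 0 < L)
    (hL : 8 * d ^ 2 ≤ L) (hB : ∀ i ≤ L, |p.eval (i : ℝ)| ≤ B)
    (hx : x ∈ Icc (0 : ℝ) L) (hy : y ∈ Icc (0 : ℝ) L) :
    |p.eval y - p.eval x| ≤ 8 * d ^ 2 * B / L * |y - x| := by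
  have hLip := abs_eval_sub_eval_le hp (Nat.cast_pos.2 hL0)
    (fun t ht => abs_eval_le_two_mul_of_forall_nat hp hL0 hL hB ht) hx hy
  exact hLip.trans_eq (by rw [sub_zero]; ring)

end Markov

section Newton

open Polynomial Finset

theorem exists_polynomial_of_fwdDiff_eq_zero {K : Type*} [Field K] [CharZero K] (h : ℕ → K)
    {d L : ℕ} (hh : ∀ k, d < k → k ≤ L → (fwdDiff 1)^[k] h 0 = 0) :
    ∃ p : K[X], p.natDegree ≤ d ∧ ∀ t ≤ L, p.eval (t : K) = h t := by
  refine ⟨∑ k ∈ range (d + 1), C ((fwdDiff 1)^[k] h 0 / (k.factorial : K)) * descPochhammer K k,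
    natDegree_sum_le_of_forall_le _ _ fun k hk => ?_, fun t ht => ?_⟩
  · refine (natDegree_C_mul_le _ _).trans ?_
    rw [descPochhammer_natDegree]
    exact mem_range_succ_iff.1 hk
  have hterm : ∀ k, (C ((fwdDiff 1)^[k] h 0 / (k.factorial : K)) * descPochhammer K k).eval
      (t : K) = t.choose k • (fwdDiff 1)^[k] h 0 := by
    intro k
    rw [eval_mul, eval_C, nsmul_eq_mul, Nat.cast_choose_eq_descPochhammer_div]
    ring
  have hNewton : h t = ∑ k ∈ range (t + 1), t.choose k • (fwdDiff 1)^[k] h 0 := by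
    simpa only [smul_eq_mul, mul_one, zero_add] using shift_eq_sum_fwdDiff_iter 1 h t 0
  rw [hNewton, eval_finsetSum]
  simp only [hterm]
  refine sum_congr_of_eq_on_inter (fun k _ hk => ?_) (fun k hk hkd => ?_) fun _ _ _ => rfl
  · rw [Nat.choose_eq_zero_of_lt (by simpa using hk), zero_smul]
  · rw [mem_range] at hk hkd
    rw [hh k (by omega) (by omega), smul_zero]

theorem fwdDiff_iter_card_eq_sum_powerset {ι G : Type*} [AddCommGroup G] (h : ℕ → G)
    (W : Finset ι) :
    (fwdDiff 1)^[#W] h 0 = ∑ V ∈ W.powerset, (-1 : ℤ) ^ (#W - #V) • h #V := by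
  rw [fwdDiff_iter_eq_sum_shift, sum_powerset_apply_card fun j => (-1 : ℤ) ^ (#W - j) • h j]
  refine sum_congr rfl fun j _ => ?_
  rw [smul_eq_mul, mul_one, zero_add, mul_comm, mul_smul, natCast_zsmul]

end Newton

/-- The functions of degree at most `d` in the letters of a word `x : ι → α`: sums of functions
each of which depends on at most `d` positions. No scalars are needed, since a scalar multiple of
such a summand is again one. -/
def degreeLE (ι α A : Type*) [AddCommGroup A] (d : ℕ) : AddSubgroup ((ι → α) → A) :=
  AddSubgroup.closure {g | ∃ U : Finset ι, U.card ≤ d ∧ DependsOn g (U : Set ι)}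

section Degree

open Finset

variable {ι α A : Type*} [AddCommGroup A] {d e : ℕ}

theorem mem_degreeLE_of_dependsOn {g : (ι → α) → A} {U : Finset ι} (hg : DependsOn g (U : Set ι))
    (hU : #U ≤ d) : g ∈ degreeLE ι α A d :=
  AddSubgroup.subset_closure ⟨U, hU, hg⟩

theorem const_mem_degreeLE (c : A) : (fun _ => c) ∈ degreeLE ι α A d :=
  mem_degreeLE_of_dependsOn (U := ∅) (fun _ _ _ => rfl) (Nat.zero_le d)

theorem degreeLE_mono (hde : d ≤ e) : degreeLE ι α A d ≤ degreeLE ι α A e :=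
  AddSubgroup.closure_mono fun _ ⟨U, hU, hg⟩ => ⟨U, hU.trans hde, hg⟩

theorem map_mem_degreeLE {A' : Type*} [AddCommGroup A'] (φ : A →+ A') {f : (ι → α) → A}
    (hf : f ∈ degreeLE ι α A d) : (fun x => φ (f x)) ∈ degreeLE ι α A' d := by
  refine (AddSubgroup.closure_le (K := (degreeLE ι α A' d).comap (φ.compLeft _))).2 ?_ hf
  rintro f ⟨U, hU, hfU⟩
  exact mem_degreeLE_of_dependsOn (fun _ _ hxy => congrArg φ (hfU hxy)) hU

theorem comp_perm_mem_degreeLE {f : (ι → α) → A} (hf : f ∈ degreeLE ι α A d)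
    (σ : Equiv.Perm ι) : (fun x => f (x ∘ σ)) ∈ degreeLE ι α A d := by
  induction hf using AddSubgroup.closure_induction with
  | mem f hf =>
    obtain ⟨U, hU, hfU⟩ := hf
    refine mem_degreeLE_of_dependsOn (U := U.map σ.toEmbedding)
      (fun x y hxy => hfU fun i hi => hxy (σ i) ?_) (by rwa [card_map])
    simpa using hi
  | zero => exact zero_mem _
  | add _ _ _ _ hf hg => exact add_mem hf hg
  | neg _ _ hf => exact neg_mem hf

theorem mul_mem_degreeLE {R : Type*} [Ring R] {f g : (ι → α) → R} (hf : f ∈ degreeLE ι α R d)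
    (hg : g ∈ degreeLE ι α R e) : f * g ∈ degreeLE ι α R (d + e) := by
  classical
  induction hf using AddSubgroup.closure_induction with
  | mem f hf =>
    obtain ⟨U, hU, hfU⟩ := hf
    induction hg using AddSubgroup.closure_induction with
    | mem g hg =>
      obtain ⟨V, hV, hgV⟩ := hg
      refine mem_degreeLE_of_dependsOn (U := U ∪ V) (fun x y hxy => ?_)
        ((card_union_le U V).trans (Nat.add_le_add hU hV))
      rw [Pi.mul_apply, Pi.mul_apply, hfU fun i hi => hxy i (mem_union_left V hi),
        hgV fun i hi => hxy i (mem_union_right U hi)]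
    | zero => rw [mul_zero]; exact zero_mem _
    | add _ _ _ _ hg hg' => rw [mul_add]; exact add_mem hg hg'
    | neg _ _ hg => rw [mul_neg]; exact neg_mem hg
  | zero => rw [zero_mul]; exact zero_mem _
  | add _ _ _ _ hf hf' => rw [add_mul]; exact add_mem hf hf'
  | neg _ _ hf => rw [neg_mul]; exact neg_mem hf

theorem apply_letter_mem_degreeLE {R : Type*} [Ring R] [Finite α] {f : α → (ι → α) → R}
    (hf : ∀ a, f a ∈ degreeLE ι α R d) (i : ι) :
    (fun x => f (x i) x) ∈ degreeLE ι α R (d + 1) := by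
  classical
  cases nonempty_fintype α
  have hsum : (fun x => f (x i) x) = ∑ a, f a * fun x => if x i = a then 1 else 0 := by
    funext x
    simp only [Finset.sum_apply, Pi.mul_apply, mul_ite, mul_one, mul_zero, sum_ite_eq, mem_univ,
      if_true]
  rw [hsum]
  refine sum_mem fun a _ => mul_mem_degreeLE (hf a) ?_
  refine mem_degreeLE_of_dependsOn (U := {i}) (fun x y hxy => ?_) (card_singleton i).le
  simp only [hxy i (mem_singleton_self i)]

theorem sum_powerset_piecewise_eq_zero [DecidableEq ι] {f : (ι → α) → A}
    (hf : f ∈ degreeLE ι α A d) {W : Finset ι} (hW : d < #W) (u v : ι → α) :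
    ∑ V ∈ W.powerset, (-1 : ℤ) ^ (#W - #V) • f (V.piecewise u v) = 0 := by
  induction hf using AddSubgroup.closure_induction with
  | mem f hf =>
    obtain ⟨U, hU, hfU⟩ := hf
    obtain ⟨w, hwW, hwU⟩ := exists_mem_notMem_of_card_lt_card (hU.trans_lt hW)
    rw [← insert_erase hwW, sum_powerset_insert (notMem_erase w W), ← sum_add_distrib,
      insert_erase hwW]
    refine sum_eq_zero fun V hV => ?_
    have hwV : w ∉ V := fun h => notMem_erase w W (mem_powerset.1 hV h)
    have hVW : #(insert w V) ≤ #W :=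
      card_le_card (insert_subset hwW ((mem_powerset.1 hV).trans (erase_subset w W)))
    have hf_insert : f ((insert w V).piecewise u v) = f (V.piecewise u v) :=
      hfU fun i hi => piecewise_insert_of_ne _ _ _ fun h => hwU (by simpa [h] using hi)
    rw [card_insert_of_notMem hwV] at hVW ⊢
    rw [hf_insert, ← add_smul, show #W - #V = #W - (#V + 1) + 1 by omega, pow_succ]
    simp
  | zero => simp
  | add f g _ _ hf hg => simp only [Pi.add_apply, smul_add, sum_add_distrib, hf, hg, add_zero]
  | neg f _ hf => simp only [Pi.neg_apply, smul_neg, sum_neg_distrib, hf, neg_zero]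

/- This is Minsky–Papert symmetrization: the `k`-th difference at `0` of `#V ↦ f (V.piecewise u v)`
is the alternating sum of `f` over a `k`-dimensional cube, and vanishes for `d < k`. -/
theorem exists_polynomial_eval_card_eq [DecidableEq ι] {K : Type*} [Field K] [CharZero K]
    {f : (ι → α) → K} (hf : f ∈ degreeLE ι α K d) (u v : ι → α) {S : Finset ι}
    (hcard : ∀ V ⊆ S, ∀ V' ⊆ S, #V = #V' → f (V.piecewise u v) = f (V'.piecewise u v)) :
    ∃ p : Polynomial K, p.natDegree ≤ d ∧ ∀ V ⊆ S, p.eval (#V : K) = f (V.piecewise u v) := by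
  let h : ℕ → K := Function.extend (fun V : S.powerset => #V.1) (fun V => f (V.1.piecewise u v)) 0
  have hh : ∀ V ⊆ S, h #V = f (V.piecewise u v) := fun V hV =>
    Function.FactorsThrough.extend_apply
      (fun V V' hVV' => hcard _ (mem_powerset.1 V.2) _ (mem_powerset.1 V'.2) hVV') 0
      (⟨V, mem_powerset.2 hV⟩ : S.powerset)
  obtain ⟨p, hp, hph⟩ := exists_polynomial_of_fwdDiff_eq_zero h (d := d) (L := #S) <| by
    intro k hdk hkS
    obtain ⟨W, hWS, rfl⟩ := exists_subset_card_eq hkS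
    rw [fwdDiff_iter_card_eq_sum_powerset, ← sum_powerset_piecewise_eq_zero hf hdk u v]
    exact sum_congr rfl fun V hV => by rw [hh V ((mem_powerset.1 hV).trans hWS)]
  exact ⟨p, hp, fun V hV => (hph _ (card_le_card hV)).trans (hh V hV)⟩

end Degree

namespace QuantumAlgorithm

variable {n M d : ℕ}

theorem oracle_mem_degreeLE {W : Type} {ψ : Input n M → Basis n M W → ℂ}
    (hψ : ∀ z, (fun x => ψ x z) ∈ degreeLE (Fin n) (Fin M) ℂ d) (z : Basis n M W) :
    (fun x => oracle x (ψ x) z) ∈ degreeLE (Fin n) (Fin M) ℂ (d + 1) :=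
  match z with
  | (none, b, w) => degreeLE_mono d.le_succ (hψ (none, b, w))
  | (some i, b, w) => apply_letter_mem_degreeLE (fun a => hψ (some i, b - a, w)) i

theorem mulVec_mem_degreeLE {B : Type} [Fintype B] {ψ : Input n M → B → ℂ}
    (hψ : ∀ z, (fun x => ψ x z) ∈ degreeLE (Fin n) (Fin M) ℂ d) (U : Matrix B B ℂ) (z : B) :
    (fun x => U.mulVec (ψ x) z) ∈ degreeLE (Fin n) (Fin M) ℂ d := by
  have hsum : (fun x => U.mulVec (ψ x) z) = ∑ y, fun x => U z y * ψ x y := by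
    funext x
    rw [Finset.sum_apply]
    rfl
  rw [hsum]
  exact sum_mem fun y _ => map_mem_degreeLE (AddMonoidHom.mulLeft (U z y)) (hψ y)

theorem state_mem_degreeLE (A : QuantumAlgorithm n M) (T : ℕ) (z : Basis n M A.Work) :
    (fun x => A.state x T z) ∈ degreeLE (Fin n) (Fin M) ℂ T := by
  induction T generalizing z with
  | zero => exact const_mem_degreeLE _
  | succ T ih => exact mulVec_mem_degreeLE (oracle_mem_degreeLE ih) _ z

theorem norm_sq_state_mem_degreeLE (A : QuantumAlgorithm n M) (T : ℕ) (z : Basis n M A.Work) :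
    (fun x => ‖A.state x T z‖ ^ 2) ∈ degreeLE (Fin n) (Fin M) ℝ (2 * T) := by
  have hmul := mul_mem_degreeLE (A.state_mem_degreeLE T z)
    (map_mem_degreeLE (starRingEnd ℂ).toAddMonoidHom (A.state_mem_degreeLE T z))
  have hre : (fun x => ‖A.state x T z‖ ^ 2) =
      fun x => Complex.reAddGroupHom (A.state x T z * starRingEnd ℂ (A.state x T z)) := by
    funext x
    rw [Complex.mul_conj', ← Complex.ofReal_pow]
    exact (Complex.ofReal_re _).symm
  rw [hre, two_mul]
  exact map_mem_degreeLE Complex.reAddGroupHom hmul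

theorem prob_mem_degreeLE (A : QuantumAlgorithm n M) (T : ℕ) (b : Bool) :
    (fun x => A.prob x T b) ∈ degreeLE (Fin n) (Fin M) ℝ (2 * T) := by
  have hsum : (fun x => A.prob x T b) =
      ∑ z, fun x => if A.out z = b then ‖A.state x T z‖ ^ 2 else 0 := by
    funext x
    rw [Finset.sum_apply]
    rfl
  rw [hsum]
  refine sum_mem fun z _ => ?_
  split_ifs
  · exact A.norm_sq_state_mem_degreeLE T z
  · exact const_mem_degreeLE 0

theorem sum_norm_sq_mulVec {B : Type} [Fintype B] [DecidableEq B]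
    (U : Matrix.unitaryGroup B ℂ) (ψ : B → ℂ) :
    ∑ z, ‖U.1.mulVec ψ z‖ ^ 2 = ∑ z, ‖ψ z‖ ^ 2 := by
  have hdot : ∀ φ : B → ℂ, ((∑ z, ‖φ z‖ ^ 2 : ℝ) : ℂ) = star φ ⬝ᵥ φ := by
    intro φ
    simp [dotProduct, Complex.conj_mul']
  apply Complex.ofReal_injective
  rw [hdot, hdot, Matrix.star_mulVec, Matrix.dotProduct_mulVec, Matrix.vecMul_vecMul,
    ← Matrix.star_eq_conjTranspose, Matrix.mem_unitaryGroup_iff'.1 U.2, Matrix.vecMul_one]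

theorem sum_norm_sq_oracle {W : Type} [Fintype W] (x : Input n M) (ψ : Basis n M W → ℂ) :
    ∑ z, ‖oracle x ψ z‖ ^ 2 = ∑ z, ‖ψ z‖ ^ 2 := by
  cases M with
  | zero => exact Fintype.sum_congr _ _ fun z => z.2.1.elim0
  | succ M =>
    simp only [Fintype.sum_prod_type, Fintype.sum_option, oracle]
    congr 1
    exact Fintype.sum_congr _ _ fun i =>
      (Equiv.subRight (x i)).sum_comp fun b => ∑ w, ‖ψ (some i, b, w)‖ ^ 2

theorem sum_norm_sq_state (A : QuantumAlgorithm n M) (x : Input n M) (T : ℕ) :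
    ∑ z, ‖A.state x T z‖ ^ 2 = 1 := by
  induction T with
  | zero => rw [state, sum_norm_sq_mulVec, Finset.sum_eq_single A.start] <;> simp +contextual
  | succ T ih => rw [state, sum_norm_sq_mulVec, sum_norm_sq_oracle, ih]

theorem prob_nonneg (A : QuantumAlgorithm n M) (x : Input n M) (T : ℕ) (b : Bool) :
    0 ≤ A.prob x T b :=
  Finset.sum_nonneg fun z _ => by split_ifs <;> positivity

theorem prob_true_add_prob_false (A : QuantumAlgorithm n M) (x : Input n M) (T : ℕ) :
    A.prob x T true + A.prob x T false = 1 := by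
  rw [prob, prob, ← Finset.sum_add_distrib, ← A.sum_norm_sq_state x T]
  refine Finset.sum_congr rfl fun z _ => ?_
  cases A.out z <;> simp

theorem prob_mem_Icc (A : QuantumAlgorithm n M) (x : Input n M) (T : ℕ) :
    A.prob x T true ∈ Set.Icc 0 1 :=
  ⟨A.prob_nonneg x T true, by
    linarith [A.prob_true_add_prob_false x T, A.prob_nonneg x T false]⟩

end QuantumAlgorithm

section Symmetrize

variable {ι α : Type*} [Fintype ι] [DecidableEq ι] {d : ℕ}

/-- The average of `F` over all permutations of the positions, which turns a function of words
into a symmetric one without raising its degree. -/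
noncomputable def symmetrize (F : (ι → α) → ℝ) (x : ι → α) : ℝ :=
  ∑ σ : Equiv.Perm ι, (Fintype.card (Equiv.Perm ι) : ℝ)⁻¹ * F (x ∘ σ)

theorem symmetrize_comp_perm (F : (ι → α) → ℝ) (x : ι → α) (τ : Equiv.Perm ι) :
    symmetrize F (x ∘ τ) = symmetrize F x :=
  Equiv.sum_comp (Equiv.mulLeft τ) fun σ : Equiv.Perm ι =>
    (Fintype.card (Equiv.Perm ι) : ℝ)⁻¹ * F (x ∘ σ)

theorem symmetrize_mem_degreeLE {F : (ι → α) → ℝ} (hF : F ∈ degreeLE ι α ℝ d) :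
    symmetrize F ∈ degreeLE ι α ℝ d := by
  have hsum : symmetrize F = ∑ σ : Equiv.Perm ι, fun x =>
      (Fintype.card (Equiv.Perm ι) : ℝ)⁻¹ * F (x ∘ σ) := by
    funext x
    rw [Finset.sum_apply]
    rfl
  rw [hsum]
  exact sum_mem fun σ _ =>
    map_mem_degreeLE (AddMonoidHom.mulLeft _) (comp_perm_mem_degreeLE hF σ)

theorem symmetrize_mem_of_convex {F : (ι → α) → ℝ} {s : Set ℝ} (hs : Convex ℝ s) {x : ι → α}
    (hF : ∀ σ : Equiv.Perm ι, F (x ∘ σ) ∈ s) : symmetrize F x ∈ s :=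
  hs.sum_mem (fun _ _ => by positivity) (by simp) fun σ _ => hF σ

end Symmetrize

section LetterCount

open Finset

variable {ι α : Type*} [Fintype ι] [DecidableEq α]

/-- The number of occurrences of the letter `a` in the word `x`. The function `letterCount x` is
the type of `x`. -/
def letterCount (x : ι → α) (a : α) : ℕ := #{i | x i = a}

theorem sum_letterCount [Fintype α] (x : ι → α) : ∑ a, letterCount x a = Fintype.card ι :=
  (card_eq_sum_card_fiberwise fun _ _ => mem_coe.2 (mem_univ _)).symm

theorem exists_perm_of_letterCount_eq {x y : ι → α} (h : letterCount x = letterCount y) :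
    ∃ σ : Equiv.Perm ι, y = x ∘ σ := by
  have hfiber : ∀ a, Nonempty ({i // y i = a} ≃ {i // x i = a}) := fun a =>
    Fintype.card_eq.1 <| by
      simpa only [letterCount, ← Fintype.card_subtype] using (congrFun h a).symm
  exact ⟨Equiv.ofFiberEquiv fun a => (hfiber a).some,
    funext fun i => (Equiv.ofFiberEquiv_map _ i).symm⟩

theorem eq_of_letterCount_eq {β : Type*} {F : (ι → α) → β} {x y : ι → α}
    (hsymm : ∀ x, ∀ σ : Equiv.Perm ι, F (x ∘ σ) = F x) (h : letterCount x = letterCount y) :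
    F x = F y := by
  obtain ⟨σ, rfl⟩ := exists_perm_of_letterCount_eq h
  exact (hsymm x σ).symm

theorem exists_card_div_card_le_letterCount [Fintype α] [Nonempty α] (x : ι → α) :
    ∃ b, (Fintype.card ι : ℝ) / Fintype.card α ≤ letterCount x b := by
  obtain ⟨b, -, hb⟩ := exists_le_of_sum_le (s := univ) (f := fun _ : α =>
    (Fintype.card ι : ℝ) / Fintype.card α) (g := fun a => (letterCount x a : ℝ)) univ_nonempty <| by
      rw [← Nat.cast_sum, sum_letterCount, sum_const, card_univ, nsmul_eq_mul]
      exact (mul_div_cancel₀ _ (by simp)).le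
  exact ⟨b, hb⟩

/-- The empirical distribution of the letters of `x`, a point of `α → ℝ` with the supremum metric;
it is `0` if `x` is empty. -/
noncomputable def letterFreq (x : ι → α) (a : α) : ℝ := letterCount x a / Fintype.card ι

theorem abs_letterCount_sub_le [Fintype α] (x y : ι → α) (a : α) :
    |(letterCount x a : ℝ) - letterCount y a| ≤
      Fintype.card ι * dist (letterFreq x) (letterFreq y) := by
  rcases isEmpty_or_nonempty ι with hι | hι
  · simp [letterCount]
  · have hn : (0 : ℝ) < Fintype.card ι := Nat.cast_pos.2 Fintype.card_pos
    have hdist := dist_le_pi_dist (letterFreq x) (letterFreq y) a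
    rwa [Real.dist_eq, letterFreq, letterFreq, ← sub_div, abs_div, abs_of_pos hn, div_le_iff₀' hn]
      at hdist

theorem one_le_card_mul_dist_letterFreq [Fintype α] {x y : ι → α}
    (hxy : letterCount x ≠ letterCount y) :
    1 ≤ Fintype.card ι * dist (letterFreq x) (letterFreq y) := by
  obtain ⟨a, ha⟩ := Function.ne_iff.1 hxy
  refine le_trans ?_ (abs_letterCount_sub_le x y a)
  exact_mod_cast Int.one_le_abs (sub_ne_zero.2 (Nat.cast_injective.ne ha))

variable [DecidableEq ι]

theorem letterCount_piecewise_const {x : ι → α} {b : α} {V : Finset ι} (hV : ∀ i ∈ V, x i = b)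
    (a c : α) : letterCount (V.piecewise (fun _ => a) x) c + (if b = c then #V else 0) =
      letterCount x c + if a = c then #V else 0 := by
  have hcard : ∀ a, (if a = c then #V else 0) =
      ∑ i, if i ∈ V then if a = c then 1 else 0 else 0 := by
    intro a
    rw [sum_ite_mem, univ_inter, sum_const, smul_eq_mul, mul_ite, mul_one, mul_zero]
  simp only [letterCount, card_filter, hcard, ← sum_add_distrib]
  refine sum_congr rfl fun i _ => ?_
  by_cases hi : i ∈ V
  · simp only [piecewise_eq_of_mem _ _ _ hi, hi, hV i hi, if_true, add_comm]
  · simp only [piecewise_eq_of_notMem _ _ _ hi, hi, if_false]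

/- Both words are moved to a common type by overwriting the letters that one of them has in excess
of the other with the letter `b`. -/
theorem exists_letterCount_piecewise_eq_min [Fintype α] (x y : ι → α) (b : α) :
    ∃ D : Finset ι, #D = ∑ a, (letterCount x a - letterCount y a) ∧ ∀ a ≠ b,
      letterCount (D.piecewise (fun _ => b) x) a = min (letterCount x a) (letterCount y a) := by
  have hex : ∀ a, ∃ E ⊆ ({i | x i = a} : Finset ι), #E = letterCount x a - letterCount y a :=
    fun a => exists_subset_card_eq (Nat.sub_le _ _)
  choose E hE hE_card using hex
  refine ⟨univ.filter fun i => i ∈ E (x i), ?_, fun a hab => ?_⟩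
  · rw [card_eq_sum_card_fiberwise (t := univ) (f := x) fun _ _ => mem_coe.2 (mem_univ _)]
    refine sum_congr rfl fun a _ => ?_
    rw [← hE_card, filter_filter]
    congr 1
    ext i
    have hmem : i ∈ E a → x i = a := fun hi => (mem_filter.1 (hE a hi)).2
    simp only [mem_filter, mem_univ, true_and]
    exact ⟨fun ⟨hi, hia⟩ => hia ▸ hi, fun hi => ⟨(hmem hi).symm ▸ hi, hmem hi⟩⟩
  · have hsdiff :
        univ.filter (fun i => (univ.filter fun i => i ∈ E (x i)).piecewise (fun _ => b) x i = a) =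
          (univ.filter fun i => x i = a) \ E a := by
      ext i
      simp only [mem_filter, mem_univ, true_and, mem_sdiff, piecewise]
      split_ifs with hi
      · exact ⟨fun hba => (hab hba.symm).elim, fun ⟨hia, hiE⟩ => (hiE (hia ▸ hi)).elim⟩
      · exact ⟨fun hia => ⟨hia, hia ▸ hi⟩, And.left⟩
    rw [letterCount, hsdiff, card_sdiff_of_subset (hE a), hE_card]
    exact tsub_tsub_eq_min _ _

end LetterCount

section Lipschitz

open Finset

variable {ι α : Type*} [Fintype ι] [DecidableEq α]
  {F : (ι → α) → ℝ} {x y : ι → α} {b : α} {d : ℕ} {B L : ℝ}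

theorem abs_update_sub_le [DecidableEq ι]
    (hsymm : ∀ x, ∀ σ : Equiv.Perm ι, F (x ∘ σ) = F x)
    (hdeg : F ∈ degreeLE ι α ℝ d) (hB : ∀ x, |F x| ≤ B) (hL0 : 0 < L) (hL : 8 * d ^ 2 ≤ L)
    (hb : L ≤ letterCount x b) (i : ι) :
    |F (Function.update x i b) - F x| ≤ 8 * d ^ 2 * B / L := by
  set v := Function.update x i b with hv
  set S : Finset ι := {j | v j = b}
  have hiS : {i} ⊆ S := singleton_subset_iff.2 <| mem_filter.2 ⟨mem_univ i, by simp [hv]⟩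
  have hLS : L ≤ #S := hb.trans <| Nat.cast_le.2 <| card_le_card fun j hj => by
    by_cases hji : j = i <;> simp_all [S]
  obtain ⟨p, hp, hpF⟩ := exists_polynomial_eval_card_eq hdeg (fun _ => x i) v (S := S) <| by
    intro V hV V' hV' hVV'
    refine eq_of_letterCount_eq hsymm (funext fun c => ?_)
    have hcV := letterCount_piecewise_const (fun j hj => (mem_filter.1 (hV hj)).2) (x i) c
    have hcV' := letterCount_piecewise_const (fun j hj => (mem_filter.1 (hV' hj)).2) (x i) c
    rw [← hVV'] at hcV'
    exact Nat.add_right_cancel (hcV.trans hcV'.symm)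
  have hF_zero : p.eval 0 = F v := by simpa using hpF ∅ (empty_subset S)
  have hF_one : p.eval 1 = F x := by
    have hx : ({i} : Finset ι).piecewise (fun _ => x i) v = x := by
      rw [piecewise_singleton, hv, Function.update_idem, Function.update_eq_self]
    simpa [hx] using hpF {i} hiS
  have hS0 : 0 < #S := Nat.cast_pos.1 (hL0.trans_le hLS)
  have hS1 : (1 : ℝ) ≤ #S := by exact_mod_cast hS0
  have hbound : ∀ k ≤ #S, |p.eval (k : ℝ)| ≤ B := by
    intro k hk
    obtain ⟨V, hVS, rfl⟩ := exists_subset_card_eq hk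
    exact hpF V hVS ▸ hB _
  calc |F v - F x| ≤ 8 * d ^ 2 * B / #S * |(0 : ℝ) - 1| := by
        rw [← hF_zero, ← hF_one]
        exact abs_eval_sub_eval_le_of_forall_nat hp hS0 (by exact_mod_cast hL.trans hLS) hbound
          ⟨zero_le_one, hS1⟩ ⟨le_rfl, Nat.cast_nonneg _⟩
    _ = 8 * d ^ 2 * B / #S := by norm_num
    _ ≤ 8 * d ^ 2 * B / L := by
        have : 0 ≤ B := (abs_nonneg _).trans (hB x)
        gcongr

theorem abs_piecewise_const_sub_le [DecidableEq ι]
    (hsymm : ∀ x, ∀ σ : Equiv.Perm ι, F (x ∘ σ) = F x)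
    (hdeg : F ∈ degreeLE ι α ℝ d) (hB : ∀ x, |F x| ≤ B) (hL0 : 0 < L) (hL : 8 * d ^ 2 ≤ L)
    (hb : L ≤ letterCount x b) (D : Finset ι) :
    |F (D.piecewise (fun _ => b) x) - F x| ≤ #D * (8 * d ^ 2 * B / L) := by
  induction D using Finset.induction_on with
  | empty => simp
  | insert i D hiD ih =>
    have hcount : letterCount x b ≤ letterCount (D.piecewise (fun _ => b) x) b :=
      card_le_card fun j hj => by simp_all [piecewise]
    have hupdate := abs_update_sub_le hsymm hdeg hB hL0 hL (hb.trans (Nat.cast_le.2 hcount)) i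
    rw [piecewise_insert, card_insert_of_notMem hiD, Nat.cast_succ, add_one_mul, add_comm]
    exact (abs_sub_le _ _ _).trans (add_le_add hupdate ih)

variable [Fintype α]

theorem abs_sub_le_sum_letterCount (hsymm : ∀ x, ∀ σ : Equiv.Perm ι, F (x ∘ σ) = F x)
    (hdeg : F ∈ degreeLE ι α ℝ d) (hB : ∀ x, |F x| ≤ B) (hL0 : 0 < L) (hL : 8 * d ^ 2 ≤ L)
    (hbx : L ≤ letterCount x b) (hby : L ≤ letterCount y b) :
    |F x - F y| ≤
      (∑ a, |(letterCount x a : ℝ) - letterCount y a|) * (8 * d ^ 2 * B / L) := by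
  classical
  obtain ⟨D, hD, hDx⟩ := exists_letterCount_piecewise_eq_min x y b
  obtain ⟨E, hE, hEy⟩ := exists_letterCount_piecewise_eq_min y x b
  set x' := D.piecewise (fun _ => b) x
  set y' := E.piecewise (fun _ => b) y
  have hne : ∀ a ≠ b, letterCount x' a = letterCount y' a := fun a hab => by
    rw [hDx a hab, hEy a hab, min_comm]
  have hcount : letterCount x' = letterCount y' := by
    funext a
    by_cases hab : a = b
    · have htotal := (sum_letterCount x').trans (sum_letterCount y').symm
      rw [← add_sum_erase _ _ (mem_univ a), ← add_sum_erase _ _ (mem_univ a)] at htotal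
      rw [sum_congr rfl fun c hc => hne c (hab ▸ ne_of_mem_erase hc)] at htotal
      exact Nat.add_right_cancel htotal
    · exact hne a hab
  have hcard : (#D : ℝ) + #E = ∑ a, |(letterCount x a : ℝ) - letterCount y a| := by
    rw [hD, hE, Nat.cast_sum, Nat.cast_sum, ← sum_add_distrib]
    refine sum_congr rfl fun a _ => ?_
    rcases le_total (letterCount x a) (letterCount y a) with h | h
    · rw [Nat.sub_eq_zero_of_le h, Nat.cast_sub h, abs_of_nonpos (by simpa using h)]
      simp
    · rw [Nat.sub_eq_zero_of_le h, Nat.cast_sub h, abs_of_nonneg (by simpa using h)]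
      simp
  calc |F x - F y| = |(F y' - F y) - (F x' - F x)| := by
        rw [eq_of_letterCount_eq hsymm hcount]
        ring_nf
    _ ≤ |F y' - F y| + |F x' - F x| := abs_sub _ _
    _ ≤ #E * (8 * d ^ 2 * B / L) + #D * (8 * d ^ 2 * B / L) := add_le_add
        (abs_piecewise_const_sub_le hsymm hdeg hB hL0 hL hby E)
        (abs_piecewise_const_sub_le hsymm hdeg hB hL0 hL hbx D)
    _ = _ := by rw [← hcard]; ring

theorem abs_sub_le_dist_letterFreq_of_le (hsymm : ∀ x, ∀ σ : Equiv.Perm ι, F (x ∘ σ) = F x)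
    (hdeg : F ∈ degreeLE ι α ℝ d) (hB : ∀ x, |F x| ≤ B) (hι : 0 < Fintype.card ι)
    (hd : 16 * d ^ 2 * Fintype.card α ≤ Fintype.card ι)
    (hxy : 2 * Fintype.card α * dist (letterFreq x) (letterFreq y) ≤ 1) :
    |F x - F y| ≤ 16 * d ^ 2 * B * Fintype.card α ^ 2 * dist (letterFreq x) (letterFreq y) := by
  have : Nonempty α := ⟨x (Fintype.card_pos_iff.1 hι).some⟩
  obtain ⟨b, hb⟩ := exists_card_div_card_le_letterCount x
  have hcount := abs_letterCount_sub_le x y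
  have hm : (0 : ℝ) < Fintype.card α := Nat.cast_pos.2 Fintype.card_pos
  set n := Fintype.card ι
  set m := Fintype.card α
  set δ := dist (letterFreq x) (letterFreq y)
  have hn : (0 : ℝ) < n := Nat.cast_pos.2 hι
  have hnm : (n : ℝ) / m = 2 * (n / (2 * m)) := by field_simp
  have hnδ : n * δ ≤ n / (2 * m) := by
    rw [le_div_iff₀ (by positivity)]
    nlinarith
  have hbx : (n : ℝ) / (2 * m) ≤ letterCount x b := by linarith [div_pos hn hm]
  have hby : (n : ℝ) / (2 * m) ≤ letterCount y b := by linarith [(abs_le.1 (hcount b)).2]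
  have hL : 8 * d ^ 2 ≤ (n : ℝ) / (2 * m) := by
    rw [le_div_iff₀ (by positivity)]
    have : 16 * d ^ 2 * m ≤ (n : ℝ) := by exact_mod_cast hd
    linarith
  calc |F x - F y|
      ≤ (∑ a, |(letterCount x a : ℝ) - letterCount y a|) * (8 * d ^ 2 * B / (n / (2 * m))) :=
        abs_sub_le_sum_letterCount hsymm hdeg hB (by positivity) hL hbx hby
    _ ≤ m * (n * δ) * (8 * d ^ 2 * B / (n / (2 * m))) := by
        have : 0 ≤ B := (abs_nonneg _).trans (hB x)
        gcongr
        refine (sum_le_card_nsmul _ _ _ fun a _ => hcount a).trans_eq ?_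
        rw [nsmul_eq_mul, card_univ]
    _ = 16 * d ^ 2 * B * m ^ 2 * δ := by field_simp; ring

/- Words of different types have frequencies at distance at least `1 / n`, so the bound exceeds `1`
unless `abs_sub_le_dist_letterFreq_of_le` applies. -/
theorem abs_sub_le_dist_letterFreq (hsymm : ∀ x, ∀ σ : Equiv.Perm ι, F (x ∘ σ) = F x)
    (hdeg : F ∈ degreeLE ι α ℝ d) (hF : ∀ x, F x ∈ Set.Icc 0 1) (hd : 0 < d) (x y : ι → α) :
    |F x - F y| ≤ 16 * d ^ 2 * Fintype.card α ^ 2 * dist (letterFreq x) (letterFreq y) := by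
  by_cases hcount : letterCount x = letterCount y
  · rw [eq_of_letterCount_eq hsymm hcount, sub_self, abs_zero]
    positivity
  have hnδ := one_le_card_mul_dist_letterFreq hcount
  have hι : 0 < Fintype.card ι := Nat.pos_of_ne_zero fun h => by
    rw [h, Nat.cast_zero, zero_mul] at hnδ
    exact absurd hnδ zero_lt_one.not_ge
  have hm : (1 : ℝ) ≤ Fintype.card α :=
    Nat.one_le_cast.2 (Fintype.card_pos_iff.2 ⟨x (Fintype.card_pos_iff.1 hι).some⟩)
  have hd1 : (1 : ℝ) ≤ d := Nat.one_le_cast.2 hd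
  by_cases hlarge : 1 ≤ 16 * d ^ 2 * Fintype.card α ^ 2 * dist (letterFreq x) (letterFreq y)
  · exact (Real.dist_le_of_mem_Icc_01 (hF x) (hF y)).trans hlarge
  push Not at hlarge
  have hδ0 : 0 < dist (letterFreq x) (letterFreq y) :=
    pos_of_mul_pos_right (one_pos.trans_le hnδ) (Nat.cast_nonneg _)
  have hdm : (1 : ℝ) ≤ d ^ 2 * Fintype.card α :=
    one_le_mul_of_one_le_of_one_le (one_le_pow₀ hd1) hm
  have hn : 16 * d ^ 2 * Fintype.card α ≤ Fintype.card ι := by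
    have : 16 * (d : ℝ) ^ 2 * Fintype.card α ^ 2 < Fintype.card ι :=
      lt_of_mul_lt_mul_right (hlarge.trans_le hnδ) hδ0.le
    have : 16 * (d : ℝ) ^ 2 * Fintype.card α ≤ Fintype.card ι := by nlinarith
    exact_mod_cast this
  have hδ : 2 * Fintype.card α * dist (letterFreq x) (letterFreq y) ≤ 1 := by
    nlinarith [mul_le_mul_of_nonneg_left hdm (mul_pos (one_pos.trans_le hm) hδ0).le]
  simpa only [mul_one] using abs_sub_le_dist_letterFreq_of_le hsymm hdeg
    (fun x => abs_le.2 ⟨by linarith [(hF x).1], (hF x).2⟩) hι hn hδ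

end Lipschitz

section Sampling

open Finset

variable {ι α : Type*} [Fintype ι] [DecidableEq α]

theorem card_mul_letterFreq (x : ι → α) (a : α) :
    Fintype.card ι * letterFreq x a = letterCount x a := by
  rcases isEmpty_or_nonempty ι with hι | hι
  · simp [letterCount]
  · exact mul_div_cancel₀ _ (by simp)

theorem sum_indicator_sub (x : ι → α) (a : α) (c : ℝ) :
    ∑ i, ((if x i = a then 1 else 0) - c) = Fintype.card ι * (letterFreq x a - c) := by
  rw [mul_sub, card_mul_letterFreq, sum_sub_distrib, sum_boole, sum_const, card_univ, nsmul_eq_mul,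
    letterCount]

theorem sum_sq_indicator_sub_letterFreq_le (x : ι → α) (a : α) :
    ∑ i, ((if x i = a then (1 : ℝ) else 0) - letterFreq x a) ^ 2 ≤ letterCount x a := by
  set c := letterFreq x a with hc
  have hsq : ∀ i, ((if x i = a then (1 : ℝ) else 0) - c) ^ 2 =
      ((if x i = a then 1 else 0) - c) * (1 - 2 * c) + c * (1 - c) := by
    intro i
    split_ifs <;> ring
  have hsum := sum_indicator_sub x a c
  rw [← hc, sub_self, mul_zero] at hsum
  simp only [hsq, sum_add_distrib, ← sum_mul, hsum, zero_mul, zero_add, sum_const, card_univ,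
    nsmul_eq_mul]
  rw [← card_mul_letterFreq x a, ← hc]
  nlinarith [mul_nonneg (Nat.cast_nonneg (α := ℝ) (Fintype.card ι)) (sq_nonneg c)]

theorem sum_sq_sum_sample {K : Type*} [CommRing K] (r : ℕ) (e : ι → K) (he : ∑ i, e i = 0) :
    (Fintype.card ι : K) * ∑ s : Fin r → ι, (∑ j, e (s j)) ^ 2 =
      r * Fintype.card ι ^ r * ∑ i, e i ^ 2 := by
  induction r with
  | zero => simp
  | succ r ih =>
    have hcons : ∑ s : Fin (r + 1) → ι, (∑ j, e (s j)) ^ 2 =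
        ∑ i, ∑ s : Fin r → ι, (e i + ∑ j, e (s j)) ^ 2 := by
      rw [← Fintype.sum_prod_type', ← (Fin.consEquiv fun _ => ι).sum_comp]
      refine sum_congr rfl fun p _ => ?_
      rw [Fin.sum_univ_succ]
      rfl
    have hexpand : ∑ i, ∑ s : Fin r → ι, (e i + ∑ j, e (s j)) ^ 2 =
        Fintype.card ι ^ r * ∑ i, e i ^ 2 +
          Fintype.card ι * ∑ s : Fin r → ι, (∑ j, e (s j)) ^ 2 := by
      simp only [add_sq, sum_add_distrib, mul_assoc, ← mul_sum, sum_const, card_univ,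
        Fintype.card_fun, Fintype.card_fin, nsmul_eq_mul, Nat.cast_pow, ← sum_mul, he, zero_mul,
        mul_zero, add_zero]
    rw [hcons, hexpand, mul_add, ih]
    push_cast
    ring

variable [Fintype α]

theorem mul_sum_sq_letterFreq_comp_sub_le (x : ι → α) (r : ℕ) :
    r * ∑ s : Fin r → ι, ∑ a, (letterFreq (x ∘ s) a - letterFreq x a) ^ 2 ≤
      (Fintype.card ι : ℝ) ^ r := by
  rcases r.eq_zero_or_pos with rfl | hr
  · simp
  rcases isEmpty_or_nonempty ι with hι | hι
  · have : Nonempty (Fin r) := ⟨⟨0, hr⟩⟩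
    simp [Finset.univ_eq_empty]
  have hn : (0 : ℝ) < Fintype.card ι := Nat.cast_pos.2 Fintype.card_pos
  have hr' : (0 : ℝ) < r := Nat.cast_pos.2 hr
  let e : α → ι → ℝ := fun a i => (if x i = a then 1 else 0) - letterFreq x a
  have he : ∀ a, ∑ i, e a i = 0 := fun a => by rw [sum_indicator_sub, sub_self, mul_zero]
  have hsample : ∀ (s : Fin r → ι) a,
      ∑ j, e a (s j) = r * (letterFreq (x ∘ s) a - letterFreq x a) := fun s a =>
    (sum_indicator_sub (x ∘ s) a _).trans (by rw [Fintype.card_fin])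
  have hvar : ∑ a, ∑ i, e a i ^ 2 ≤ Fintype.card ι := by
    rw [← sum_letterCount x, Nat.cast_sum]
    exact sum_le_sum fun a _ => sum_sq_indicator_sub_letterFreq_le x a
  refine le_of_mul_le_mul_left ?_ (mul_pos hn hr')
  calc Fintype.card ι * r *
        (r * ∑ s : Fin r → ι, ∑ a, (letterFreq (x ∘ s) a - letterFreq x a) ^ 2)
      = ∑ a, Fintype.card ι * ∑ s : Fin r → ι, (∑ j, e a (s j)) ^ 2 := by
        simp only [hsample, mul_pow, ← mul_sum]
        rw [sum_comm]
        ring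
    _ = r * Fintype.card ι ^ r * ∑ a, ∑ i, e a i ^ 2 := by
        simp only [sum_sq_sum_sample r _ (he _), mul_sum]
    _ ≤ r * Fintype.card ι ^ r * Fintype.card ι := by gcongr
    _ = Fintype.card ι * r * Fintype.card ι ^ r := by ring

theorem card_mul_le_of_forall_lt_dist_letterFreq (x : ι → α) {r : ℕ} {ε : ℝ} (hε : 0 ≤ ε)
    {S : Finset (Fin r → ι)} (hS : ∀ s ∈ S, ε < dist (letterFreq (x ∘ s)) (letterFreq x)) :
    #S * (r * ε ^ 2) ≤ (Fintype.card ι : ℝ) ^ r := by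
  have hsq : ∀ s ∈ S, ε ^ 2 ≤ ∑ a, (letterFreq (x ∘ s) a - letterFreq x a) ^ 2 := by
    intro s hs
    obtain ⟨a, ha⟩ : ∃ a, ε < dist (letterFreq (x ∘ s) a) (letterFreq x a) := by
      by_contra! hle
      exact (hS s hs).not_ge ((dist_pi_le_iff hε).2 hle)
    calc ε ^ 2 ≤ dist (letterFreq (x ∘ s) a) (letterFreq x a) ^ 2 := by gcongr
      _ = (letterFreq (x ∘ s) a - letterFreq x a) ^ 2 := by rw [Real.dist_eq, sq_abs]
      _ ≤ _ := single_le_sum (f := fun a => (letterFreq (x ∘ s) a - letterFreq x a) ^ 2)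
        (fun _ _ => sq_nonneg _) (mem_univ a)
  calc #S * (r * ε ^ 2) = r * (#S • ε ^ 2) := by rw [nsmul_eq_mul]; ring
    _ ≤ r * ∑ s ∈ S, ∑ a, (letterFreq (x ∘ s) a - letterFreq x a) ^ 2 := by
        gcongr
        exact card_nsmul_le_sum _ _ _ hsq
    _ ≤ r * ∑ s, ∑ a, (letterFreq (x ∘ s) a - letterFreq x a) ^ 2 := by
        gcongr
        exact subset_univ S
    _ ≤ _ := mul_sum_sq_letterFreq_comp_sub_le x r

end Sampling

namespace DecisionTree

variable {n M r : ℕ}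

/-- The algorithm that queries the positions `s 0, s 1, …`, whatever the answers, and applies `g`
to the answers. -/
def nonadaptive : {r : ℕ} → (Fin r → Fin n) → ((Fin r → Fin M) → Bool) → DecisionTree n M
  | 0, _, g => .leaf (g Fin.elim0)
  | _ + 1, s, g => .query (s 0) fun a => nonadaptive (Fin.tail s) fun w => g (Fin.cons a w)

theorem eval_nonadaptive (s : Fin r → Fin n) (g : (Fin r → Fin M) → Bool) (x : Input n M) :
    (nonadaptive s g).eval x = g (x ∘ s) := by
  induction r with
  | zero => exact congrArg g (Subsingleton.elim _ _)
  | succ r ih =>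
    rw [nonadaptive, eval, ih]
    exact congrArg g (Fin.cons_self_tail (x ∘ s))

theorem cost_nonadaptive (s : Fin r → Fin n) (g : (Fin r → Fin M) → Bool) (x : Input n M) :
    (nonadaptive s g).cost x = r := by
  induction r with
  | zero => rfl
  | succ r ih => rw [nonadaptive, cost, ih]

end DecisionTree

section Randomized

open Finset

variable {n M r : ℕ} {X : Set (Input n M)}

theorem R_le_length (f : X → Bool) : R f ≤ n :=
  Nat.sInf_le (exists_randomizedComputes f)

theorem R_eq_zero_of_forall_eq {f : X → Bool} (hf : ∀ x y, f x = f y) : R f = 0 := by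
  obtain ⟨b, hb⟩ : ∃ b, ∀ x, f x = b := by
    rcases isEmpty_or_nonempty X with hX | ⟨⟨y⟩⟩
    · exact ⟨true, isEmptyElim⟩
    · exact ⟨f y, fun x => hf x y⟩
  refine Nat.le_zero.1 (Nat.sInf_le ⟨PMF.pure (.leaf b), fun x => ⟨fun t ht => ?_, ?_⟩⟩)
  · rw [PMF.support_pure, Set.mem_singleton_iff] at ht
    exact ht ▸ le_rfl
  · rw [PMF.toOuterMeasure_pure_apply, if_neg] <;> simp [DecisionTree.eval, hb]

theorem R_eq_zero_of_le_one (hM : M ≤ 1) (f : X → Bool) : R f = 0 := by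
  have : Subsingleton (Fin M) := Fin.subsingleton_iff_le_one.2 hM
  exact R_eq_zero_of_forall_eq fun x y => congrArg f (Subsingleton.elim x y)

theorem R_le_of_card_lt {f : X → Bool} (g : (Fin r → Fin M) → Bool)
    (hg : ∀ x : X, 3 * #{s : Fin r → Fin n | g (x.1 ∘ s) ≠ f x} < n ^ r) : R f ≤ r := by
  rcases isEmpty_or_nonempty X with hX | ⟨⟨x₀⟩⟩
  · exact (R_eq_zero_of_forall_eq (f := f) isEmptyElim).trans_le (Nat.zero_le r)
  have hpos : 0 < n ^ r := (Nat.zero_le _).trans_lt (hg x₀)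
  have : Nonempty (Fin r → Fin n) := Fintype.card_pos_iff.1 (by simpa using hpos)
  refine Nat.sInf_le ⟨(PMF.uniformOfFintype (Fin r → Fin n)).map fun s => .nonadaptive s g,
    fun x => ⟨fun t ht => ?_, ?_⟩⟩
  · obtain ⟨s, -, rfl⟩ := (PMF.mem_support_map_iff _ _ _).1 ht
    exact (DecisionTree.cost_nonadaptive s g x).le
  have herr : (fun s => DecisionTree.nonadaptive s g) ⁻¹' {t | t.eval x.1 ≠ f x} =
      (({s | g (x.1 ∘ s) ≠ f x} : Finset (Fin r → Fin n)) : Set (Fin r → Fin n)) := by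
    ext s
    simp [DecisionTree.eval_nonadaptive]
  have hpos' : ((n ^ r : ℕ) : ENNReal) ≠ 0 := by exact_mod_cast hpos.ne'
  rw [PMF.toOuterMeasure_map_apply, herr, PMF.toOuterMeasure_uniformOfFintype_apply]
  simp only [coe_sort_coe, Fintype.card_coe, Fintype.card_fun, Fintype.card_fin]
  rw [ENNReal.div_lt_iff (Or.inl hpos') (Or.inl (ENNReal.natCast_ne_top _)), one_div, mul_comm,
    ← div_eq_mul_inv, ENNReal.lt_div_iff_mul_lt (Or.inl (by norm_num)) (Or.inl (by norm_num)),
    mul_comm]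
  exact_mod_cast hg x

/- Answer `true` if the letter frequencies of some input with value `true` are within `ε` of those
of the sample. -/
theorem R_le_of_separated {f : X → Bool} {ε : ℝ} (hε : 0 ≤ ε) (hr : 3 < r * ε ^ 2)
    (hsep : ∀ x y : X, dist (letterFreq x.1) (letterFreq y.1) ≤ 2 * ε → f x = f y) :
    R f ≤ r := by
  classical
  rcases n.eq_zero_or_pos with rfl | hn
  · exact (R_le_length f).trans (Nat.zero_le r)
  let g : (Fin r → Fin M) → Bool := fun w =>
    decide (∃ y : X, f y = true ∧ dist (letterFreq w) (letterFreq y.1) ≤ ε)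
  refine R_le_of_card_lt g fun x => ?_
  set S : Finset (Fin r → Fin n) := {s | g (x.1 ∘ s) ≠ f x}
  have hbad : ∀ s ∈ S, ε < dist (letterFreq (x.1 ∘ s)) (letterFreq x.1) := by
    intro s hs
    by_contra! hclose
    refine (mem_filter.1 hs).2 (Bool.eq_iff_iff.2 ?_)
    rw [decide_eq_true_iff]
    refine ⟨fun ⟨y, hy, hwy⟩ => (hsep x y ?_).trans hy, fun hx => ⟨x, hx, hclose⟩⟩
    linarith [dist_triangle_left (letterFreq x.1) (letterFreq y.1) (letterFreq (x.1 ∘ s))]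
  have hcard := card_mul_le_of_forall_lt_dist_letterFreq x.1 hε hbad
  rw [Fintype.card_fin] at hcard
  have hlt : (3 : ℝ) * #S < n ^ r := by
    rcases (#S).eq_zero_or_pos with h | h
    · rw [h, Nat.cast_zero, mul_zero]
      positivity
    · have : (0 : ℝ) < #S := Nat.cast_pos.2 h
      nlinarith
  exact_mod_cast hlt

end Randomized

section Comparison

open QuantumAlgorithm

variable {n M T : ℕ} {X : Set (Input n M)} {f : X → Bool} {A : QuantumAlgorithm n M}

theorem exists_quantumComputes_Q (hM : 1 ≤ M) (f : X → Bool) :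
    ∃ A : QuantumAlgorithm n M, QuantumComputes A (Q f) f :=
  Nat.sInf_mem (s := {T | ∃ A : QuantumAlgorithm n M, QuantumComputes A T f})
    ⟨n, exists_quantumComputes hM f⟩

theorem eq_of_Q_eq_zero (hM : 1 ≤ M) (hQ : Q f = 0) (x y : X) : f x = f y := by
  obtain ⟨A, hA⟩ := exists_quantumComputes_Q hM f
  rw [hQ] at hA
  have hx := hA x
  have hy : A.prob x 0 (!f y) < 1 / 3 := hA y
  have hsum := A.prob_true_add_prob_false x 0
  cases hfx : f x <;> cases hfy : f y <;> simp_all <;> linarith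

theorem prob_comp_perm_lt (hX : IsSymmetricPromise X) (hf : IsSymmetricFunction f)
    (hA : QuantumComputes A T f) (x : X) (σ : Equiv.Perm (Fin n)) :
    A.prob (x.1 ∘ σ) T (!f x) < 1 / 3 := by
  have h := hA ⟨x.1 ∘ σ, hX x x.2 σ⟩
  rwa [hf x _ σ rfl] at h

theorem symmetrize_prob_lt (hX : IsSymmetricPromise X) (hf : IsSymmetricFunction f)
    (hA : QuantumComputes A T f) {x : X} (hx : f x = false) :
    symmetrize (fun w => A.prob w T true) x.1 < 1 / 3 :=
  symmetrize_mem_of_convex (convex_Iio _) fun σ => by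
    simpa only [hx, Bool.not_false, Set.mem_Iio] using prob_comp_perm_lt hX hf hA x σ

theorem lt_symmetrize_prob (hX : IsSymmetricPromise X) (hf : IsSymmetricFunction f)
    (hA : QuantumComputes A T f) {x : X} (hx : f x = true) :
    2 / 3 < symmetrize (fun w => A.prob w T true) x.1 :=
  symmetrize_mem_of_convex (convex_Ioi _) fun σ => by
    have h := prob_comp_perm_lt hX hf hA x σ
    rw [hx, Bool.not_true] at h
    rw [Set.mem_Ioi]
    linarith [A.prob_true_add_prob_false (x.1 ∘ σ) T]

theorem lt_abs_symmetrize_prob_sub (hX : IsSymmetricPromise X) (hf : IsSymmetricFunction f)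
    (hA : QuantumComputes A T f) {x y : X} (hxy : f x ≠ f y) :
    1 / 3 < |symmetrize (fun w => A.prob w T true) x.1 -
      symmetrize (fun w => A.prob w T true) y.1| := by
  rw [lt_abs]
  rcases Bool.eq_false_or_eq_true (f x) with hx | hx
  · have hy : f y = false := by simpa [hx] using hxy.symm
    exact Or.inl (by linarith [lt_symmetrize_prob hX hf hA hx, symmetrize_prob_lt hX hf hA hy])
  · have hy : f y = true := by simpa [hx] using hxy.symm
    exact Or.inr (by linarith [symmetrize_prob_lt hX hf hA hx, lt_symmetrize_prob hX hf hA hy])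

theorem eq_of_dist_letterFreq_le (hX : IsSymmetricPromise X) (hf : IsSymmetricFunction f)
    (hA : QuantumComputes A T f) (hT : 0 < T) {x y : X}
    (hxy : 192 * M ^ 2 * T ^ 2 * dist (letterFreq x.1) (letterFreq y.1) ≤ 1) : f x = f y := by
  by_contra hne
  have hlt := lt_abs_symmetrize_prob_sub hX hf hA hne
  have hle := abs_sub_le_dist_letterFreq (d := 2 * T) (symmetrize_comp_perm _)
    (symmetrize_mem_degreeLE (A.prob_mem_degreeLE T true))
    (fun w => symmetrize_mem_of_convex (convex_Icc 0 1) fun σ => A.prob_mem_Icc (w ∘ σ) T)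
    (by positivity) x.1 y.1
  rw [Fintype.card_fin, Nat.cast_mul, Nat.cast_two] at hle
  linarith

theorem R_le_mul_Q_pow_four (hX : IsSymmetricPromise X) (hf : IsSymmetricFunction f) :
    R f ≤ 4 * 384 ^ 2 * (M ^ 4 * Q f ^ 4) := by
  rcases le_or_gt M 1 with hM | hM
  · exact (R_eq_zero_of_le_one hM f).trans_le (Nat.zero_le _)
  rcases (Q f).eq_zero_or_pos with hQ | hQ
  · exact (R_eq_zero_of_forall_eq (eq_of_Q_eq_zero hM.le hQ)).trans_le (Nat.zero_le _)
  obtain ⟨A, hA⟩ := exists_quantumComputes_Q hM.le f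
  have hpos : (0 : ℝ) < 384 * M ^ 2 * Q f ^ 2 := by positivity
  refine R_le_of_separated (ε := (384 * M ^ 2 * Q f ^ 2 : ℝ)⁻¹) (by positivity) ?_
    fun x y hxy => eq_of_dist_letterFreq_le hX hf hA hQ ?_
  · have hfour : ((4 * 384 ^ 2 * (M ^ 4 * Q f ^ 4) : ℕ) : ℝ) = 4 * (384 * M ^ 2 * Q f ^ 2) ^ 2 := by
      push_cast
      ring
    rw [hfour, mul_assoc, ← mul_pow, mul_inv_cancel₀ hpos.ne']
    norm_num
  · calc 192 * M ^ 2 * Q f ^ 2 * dist (letterFreq x.1) (letterFreq y.1)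
        ≤ 192 * M ^ 2 * Q f ^ 2 * (2 * (384 * M ^ 2 * Q f ^ 2 : ℝ)⁻¹) := by gcongr
      _ = 384 * M ^ 2 * Q f ^ 2 * (384 * M ^ 2 * Q f ^ 2 : ℝ)⁻¹ := by ring
      _ = 1 := mul_inv_cancel₀ hpos.ne'

theorem R_le_mul_Q_pow_eight (hX : IsSymmetricPromise X) (hf : IsSymmetricFunction f) :
    (R f : ℝ) ≤ 4 * 384 ^ 2 / Real.log 2 * (Q f ^ 8 * M ^ 8 * Real.log M) := by
  rcases le_or_gt M 1 with hM | hM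
  · rw [R_eq_zero_of_le_one hM f, Nat.cast_zero]
    positivity
  have hlog : Real.log 2 ≤ Real.log M := Real.log_le_log two_pos (Nat.ofNat_le_cast.2 hM)
  have hfour : (R f : ℝ) ≤ 4 * 384 ^ 2 * (M ^ 4 * Q f ^ 4) := mod_cast R_le_mul_Q_pow_four hX hf
  have hpow : ∀ k : ℕ, (k : ℝ) ^ 4 ≤ k ^ 8 := fun k => by
    rw [pow_mul (k : ℝ) 4 2]
    exact_mod_cast Nat.le_self_pow two_ne_zero (k ^ 4)
  calc (R f : ℝ) ≤ 4 * 384 ^ 2 * (M ^ 8 * Q f ^ 8) := by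
        refine hfour.trans ?_
        gcongr ?_ * (?_ * ?_)
        · exact hpow M
        · exact hpow (Q f)
    _ = 4 * 384 ^ 2 / Real.log 2 * (Q f ^ 8 * M ^ 8 * Real.log 2) := by field_simp
    _ ≤ _ := by gcongr

end Comparison

theorem inv_rpow_mul_div_le_of_le_mul {C r q m l : ℝ} {k : ℕ} (hk : k ≠ 0) (hC : 0 < C)
    (hr : 0 ≤ r) (hq : 0 ≤ q) (hm : 0 < m) (hl : 0 < l) (h : r ≤ C * (q ^ k * m ^ k * l)) :
    (C ^ (1 / k : ℝ))⁻¹ * (r ^ (1 / k : ℝ) / (m * l ^ (1 / k : ℝ))) ≤ q := by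
  have hroot : r ^ (1 / k : ℝ) ≤ C ^ (1 / k : ℝ) * (q * (m * l ^ (1 / k : ℝ))) := by
    calc r ^ (1 / k : ℝ) ≤ (C * ((q * m) ^ k * l)) ^ (1 / k : ℝ) := by
          rw [mul_pow]
          exact Real.rpow_le_rpow hr h (by positivity)
      _ = C ^ (1 / k : ℝ) * (q * (m * l ^ (1 / k : ℝ))) := by
          rw [Real.mul_rpow hC.le (by positivity), Real.mul_rpow (by positivity) hl.le, one_div,
            Real.pow_rpow_inv_natCast (by positivity) hk, mul_assoc]
  rw [inv_mul_le_iff₀ (by positivity), div_le_iff₀ (by positivity), mul_assoc]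
  exact hroot

end QueryComplexity

theorem mainTheorem3 :
    (∃ c : ℝ, 0 < c ∧
      ∀ (M n : ℕ), 2 ≤ M →
      ∀ (X : Set (QueryComplexity.Input n M)) (f : X → Bool),
        QueryComplexity.IsSymmetricPromise X →
        QueryComplexity.IsSymmetricFunction f →
        c * ((QueryComplexity.R f : ℝ) ^ (1 / 8 : ℝ) /
            ((M : ℝ) * (Real.log (M : ℝ)) ^ (1 / 8 : ℝ)))
          ≤ (QueryComplexity.Q f : ℝ)) ∧
    (∃ C : ℝ, 0 < C ∧
      ∀ (M n : ℕ), 1 ≤ M →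
      ∀ (X : Set (QueryComplexity.Input n M)) (f : X → Bool),
        QueryComplexity.IsSymmetricPromise X →
        QueryComplexity.IsSymmetricFunction f →
        (QueryComplexity.R f : ℝ)
          ≤ C * ((QueryComplexity.Q f : ℝ) ^ 8 * (M : ℝ) ^ 8 * Real.log (M : ℝ))) := by
  set C : ℝ := 4 * 384 ^ 2 / Real.log 2
  have hC : 0 < C := by positivity
  refine ⟨⟨(C ^ (1 / 8 : ℝ))⁻¹, by positivity, fun M n hM X f hX hf => ?_⟩,
    C, hC, fun M n _ X f hX hf => QueryComplexity.R_le_mul_Q_pow_eight hX hf⟩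
  have hlog : 0 < Real.log M := Real.log_pos (Nat.one_lt_cast.2 hM)
  exact_mod_cast QueryComplexity.inv_rpow_mul_div_le_of_le_mul (by decide : 8 ≠ 0) hC
    (Nat.cast_nonneg _) (Nat.cast_nonneg _) (by positivity) hlog
    (QueryComplexity.R_le_mul_Q_pow_eight hX hf)
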